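/- For $n \ge 1$ and $\Omega \subset \mathbb{C}$ let $\mathcal{D}_n(\Omega)$ be the set of all diagonalizable complex $n \times n$ matrices all of whose eigenvalues lie in $\Omega$. For $f\colon \Omega \to \mathbb{C}$ and $X = P\,\mathrm{Diag}(\lambda_1,\ldots,\lambda_n)P^{-1} \in \mathcal{D}_n(\Omega)$ (with $P$ invertible and $\lambda_1,\ldots,\lambda_n \in \Omega$) put $f[X] = P\,\mathrm{Diag}(f(\lambda_1),\ldots,f(\lambda_n))P^{-1}$; this does not depend on the choice of the decomposition. Let $I_n$ be the $n \times n$ unit matrix and let $\|\cdot\|$ be the operator norm on complex $n \times n$ matrices induced by the standard inner product on $\mathbb{C}^n$. Theorem. Let $\Omega \subset \mathbb{C}$ and $f\colon \Omega \to \mathbb{C}$ be arbitrary. The following conditions are equivalent: (i) for every $\lambda \in \Omega$ there are real constants $M > 0$ and $\varepsilon > 0$ such that for all $n \ge 1$ and all $X \in \mathcal{D}_n(\Omega)$ with $\|X - \lambda I_n\| \le \varepsilon$ one has $\|f[X]\| \le M$; (ii) for every $\lambda \in \Omega$ and every $\varepsilon > 0$ there is $\delta > 0$ such that for all $n \ge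 1$ and all $X \in \mathcal{D}_n(\Omega)$ with $\|X - \lambda I_n\| \le \delta$ one has $\|f[X] - f[\lambda I_n]\| \le \varepsilon$; (iii) $f$ extends to a holomorphic function on an open superset of $\Omega$, that is, there are an open set $U \supset \Omega$ and a holomorphic function $g\colon U \to \mathbb{C}$ with $g(z) = f(z)$ for all $z \in \Omega$. -/

import Mathlib

/- The norm on complex matrices is the operator norm induced by the standard inner product. -/
open scoped Matrix.Norms.L2Operator

namespace DiagCalc

/-- A complex square matrix is diagonalizable if it is similar to a diagonal matrix. -/
def IsDiagonalizable {n : ℕ} (X : Matrix (Fin n) (Fin n) ℂ) : Prop :=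
  ∃ (P : (Matrix (Fin n) (Fin n) ℂ)ˣ) (d : Fin n → ℂ),
    X = P.val * Matrix.diagonal d * P⁻¹.val

/-- `D n Ω` is the set of all diagonalizable `n × n` complex matrices all of whose eigenvalues
lie in `Ω`. -/
def D (n : ℕ) (Ω : Set ℂ) : Set (Matrix (Fin n) (Fin n) ℂ) :=
  {X | IsDiagonalizable X ∧ spectrum ℂ X ⊆ Ω}

theorem mem_D_iff {n : ℕ} {Ω : Set ℂ} {X : Matrix (Fin n) (Fin n) ℂ} :
    X ∈ D n Ω ↔ ∃ (P : (Matrix (Fin n) (Fin n) ℂ)ˣ) (d : Fin n → Ω),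
      X = P.val * Matrix.diagonal (fun i => (d i : ℂ)) * P⁻¹.val := by
  constructor
  · rintro ⟨⟨P, d, rfl⟩, h⟩
    rw [spectrum.units_conjugate, spectrum_diagonal] at h
    exact ⟨P, fun i => ⟨d i, h ⟨i, rfl⟩⟩, rfl⟩
  · rintro ⟨P, d, rfl⟩
    refine ⟨⟨P, _, rfl⟩, ?_⟩
    rw [spectrum.units_conjugate, spectrum_diagonal]
    rintro _ ⟨i, rfl⟩
    exact (d i).2

/-- `f[X]` for `X ∈ D n Ω`: write `X = P diag(λ₁, …, λₙ) P⁻¹` with `λᵢ ∈ Ω` and put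
`f[X] = P diag(f(λ₁), …, f(λₙ)) P⁻¹`. By `fop_eq` below the result does not depend on
the chosen decomposition. -/
noncomputable def fop {Ω : Set ℂ} (f : Ω → ℂ) {n : ℕ} (X : D n Ω) :
    Matrix (Fin n) (Fin n) ℂ :=
  let P := (mem_D_iff.1 X.2).choose
  let d := (mem_D_iff.1 X.2).choose_spec.choose
  P.val * Matrix.diagonal (fun i => f (d i)) * P⁻¹.val

/-- The defining property of `f[X]`, for every decomposition of `X`. -/
theorem fop_eq {Ω : Set ℂ} (f : Ω → ℂ) {n : ℕ} (X : D n Ω)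
    (Q : (Matrix (Fin n) (Fin n) ℂ)ˣ) (e : Fin n → Ω)
    (h : X.val = Q.val * Matrix.diagonal (fun i => (e i : ℂ)) * Q⁻¹.val) :
    fop f X = Q.val * Matrix.diagonal (fun i => f (e i)) * Q⁻¹.val := by
  have hP := (mem_D_iff.1 X.2).choose_spec.choose_spec
  unfold fop
  set P := (mem_D_iff.1 X.2).choose
  set d := (mem_D_iff.1 X.2).choose_spec.choose
  have key : ∀ A B : Matrix (Fin n) (Fin n) ℂ,
      P.val * A * P⁻¹.val = Q.val * B * Q⁻¹.val ↔
        (Q⁻¹.val * P.val) * A = B * (Q⁻¹.val * P.val) := by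
    intro A B
    rw [Units.mul_inv_eq_iff_eq_mul, mul_assoc Q.val, mul_assoc Q.val,
      ← Units.inv_mul_eq_iff_eq_mul]
    simp only [mul_assoc]
  have h1 := (key _ _).1 (hP.symm.trans h)
  refine (key _ _).2 ?_
  ext i j
  have h2 := congrFun (congrFun h1 i) j
  rw [Matrix.mul_diagonal, Matrix.diagonal_mul] at h2 ⊢
  by_cases hs : (Q⁻¹.val * P.val) i j = 0
  · rw [hs]; simp
  · rw [mul_comm] at h2
    have : d j = e i := Subtype.ext (mul_right_cancel₀ hs h2)
    rw [this, mul_comm]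

/-- The scalar matrix `λ Iₙ`, as an element of `D n Ω`, for `λ ∈ Ω`. -/
noncomputable def scalarD {Ω : Set ℂ} (n : ℕ) (l : Ω) : D n Ω :=
  ⟨(l : ℂ) • (1 : Matrix (Fin n) (Fin n) ℂ), mem_D_iff.2 ⟨1, fun _ => l, by
    simp [Matrix.smul_one_eq_diagonal]⟩⟩

end DiagCalc

/-! ### Bidiagonal matrices and their polynomial calculus. -/

namespace DiagCalc

open Matrix Polynomial Finset

/-! The hard implication is (i) ⇒ (iii). A bidiagonal matrix with distinct diagonal entries in `Ω`
and superdiagonal `t` is diagonalizable, and the corner entry of `f[X]` is `t ^ m` times the divided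
difference of `f` at those entries. A bound on `f[X]` uniform in `n` thus makes divided differences
grow at most geometrically (`norm_coeff_interp_mul_pow_le`), so Newton interpolation at points of
`Ω` near an accumulation point converges to a holomorphic extension of `f`
(`exists_holomorphic_near_accPt`). Isolated points impose no condition, and the local extensions are
glued in `exists_holomorphic_extension`.

For (iii) ⇒ (ii), the power series at `λ` is evaluated at `X - λI`; its estimates involve only
norms, hence not `n`. Then (ii) with `ε = 1` gives (i). -/

theorem norm_entry_le_l2_opNorm {m : ℕ} (A : Matrix (Fin m) (Fin m) ℂ) (i j : Fin m) :
    ‖A i j‖ ≤ ‖A‖ := by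
  have h := Matrix.l2_opNorm_mulVec A (EuclideanSpace.single j (1 : ℂ))
  rw [PiLp.norm_single, norm_one, mul_one] at h
  refine le_trans ?_ ((PiLp.norm_apply_le _ i).trans h)
  simp

/-- The nilpotent shift matrix, with ones on the superdiagonal. -/
def shift (m : ℕ) : Matrix (Fin m) (Fin m) ℂ :=
  Matrix.of fun i j => if i.val + 1 = j.val then 1 else 0

theorem conjTranspose_shift_mul_shift (m : ℕ) :
    (shift m)ᴴ * shift m = Matrix.diagonal fun i : Fin m => if i.val = 0 then 0 else 1 := by
  ext i j
  rw [Matrix.mul_apply, Matrix.diagonal_apply]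
  simp only [shift, conjTranspose_apply, of_apply]
  rcases eq_or_ne i.val 0 with hi | hi
  · rw [Finset.sum_eq_zero]
    · simp [hi]
    · intro k _
      rw [if_neg (by omega)]
      simp
  · rw [Finset.sum_eq_single (⟨i.val - 1, by omega⟩ : Fin m)]
    · have h1 : i.val - 1 + 1 = i.val := by omega
      by_cases hij : i = j
      · subst hij; simp [h1, hi]
      · have : i.val ≠ j.val := fun h => hij (Fin.ext h)
        simp [h1, hij, this]
    · intro k _ hk
      have : k.val ≠ i.val - 1 := fun h => hk (Fin.ext h)
      rw [if_neg (by omega)]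
      simp
    · simp

theorem norm_shift_le_one (m : ℕ) : ‖shift m‖ ≤ 1 := by
  have h := Matrix.l2_opNorm_conjTranspose_mul_self (shift m)
  rw [conjTranspose_shift_mul_shift, Matrix.l2_opNorm_diagonal] at h
  have h2 : ‖(fun i : Fin m => if i.val = 0 then (0 : ℂ) else 1)‖ ≤ 1 := by
    refine (pi_norm_le_iff_of_nonneg zero_le_one).2 fun i => ?_
    split_ifs <;> simp
  nlinarith [norm_nonneg (shift m)]

/-- The upper bidiagonal matrix with diagonal `v` and constant superdiagonal `t`. -/
noncomputable def bidiagonal {m : ℕ} (v : Fin m → ℂ) (t : ℂ) : Matrix (Fin m) (Fin m) ℂ :=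
  Matrix.diagonal v + t • shift m

theorem bidiagonal_apply {m : ℕ} (v : Fin m → ℂ) (t : ℂ) (i j : Fin m) :
    bidiagonal v t i j = (if i = j then v i else 0) + (if i.val + 1 = j.val then t else 0) := by
  simp [bidiagonal, shift, Matrix.diagonal_apply]

theorem norm_bidiagonal_sub_le {m : ℕ} (v : Fin m → ℂ) (t l : ℂ) {r : ℝ} (hr : 0 ≤ r)
    (hv : ∀ i, ‖v i - l‖ ≤ r) :
    ‖bidiagonal v t - l • (1 : Matrix (Fin m) (Fin m) ℂ)‖ ≤ r + ‖t‖ := by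
  have h : bidiagonal v t - l • (1 : Matrix (Fin m) (Fin m) ℂ) =
      Matrix.diagonal (fun i => v i - l) + t • shift m := by
    rw [bidiagonal, Matrix.smul_one_eq_diagonal, ← Matrix.diagonal_sub]
    abel
  rw [h]
  refine (norm_add_le _ _).trans (add_le_add ?_ ?_)
  · rw [Matrix.l2_opNorm_diagonal]
    exact (pi_norm_le_iff_of_nonneg hr).2 hv
  · rw [norm_smul]
    exact mul_le_of_le_one_right (norm_nonneg _) (norm_shift_le_one m)

theorem exists_eigenvector_bidiagonal {m : ℕ} (v : Fin m → ℂ) (t : ℂ) (i : Fin m) :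
    ∃ w : Fin m → ℂ, w ≠ 0 ∧ bidiagonal v t *ᵥ w = v i • w := by
  have hdet : (bidiagonal v t - v i • (1 : Matrix (Fin m) (Fin m) ℂ)).det = 0 := by
    rw [Matrix.det_of_isUpperTriangular]
    · refine Finset.prod_eq_zero (Finset.mem_univ i) ?_
      simp [bidiagonal_apply]
    · intro a b hab
      have hab' : b.val < a.val := hab
      have hne : a ≠ b := fun h => by simp [h] at hab'
      simp [bidiagonal_apply, hne]
      omega
  obtain ⟨w, hw, h⟩ := Matrix.exists_mulVec_eq_zero_iff.2 hdet
  refine ⟨w, hw, ?_⟩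
  rwa [Matrix.sub_mulVec, Matrix.smul_mulVec, Matrix.one_mulVec, sub_eq_zero] at h

/-- Eigenvectors for distinct eigenvalues are independent, so they form the columns of an invertible
`P`. -/
theorem exists_eq_conj_diagonal_bidiagonal {m : ℕ} {v : Fin m → ℂ}
    (hv : Function.Injective v) (t : ℂ) :
    ∃ P : (Matrix (Fin m) (Fin m) ℂ)ˣ,
      bidiagonal v t = P.val * Matrix.diagonal v * P⁻¹.val := by
  choose w hw0 hw using exists_eigenvector_bidiagonal v t
  have hli : LinearIndependent ℂ w :=
    Module.End.eigenvectors_linearIndependent' (Matrix.toLin' (bidiagonal v t)) v hv w fun i =>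
      ⟨Module.End.mem_eigenspace_iff.2 (by rw [Matrix.toLin'_apply, hw]), hw0 i⟩
  obtain ⟨P, hP⟩ := Matrix.linearIndependent_cols_iff_isUnit.1
    (show LinearIndependent ℂ (Matrix.of fun i j => w j i).col from hli)
  refine ⟨P, ?_⟩
  rw [Units.eq_mul_inv_iff_mul_eq, hP]
  ext i j
  rw [Matrix.mul_diagonal]
  have := congrFun (hw j) i
  simpa [Matrix.mul_apply, Matrix.mulVec, dotProduct, mul_comm] using this

/-- Each factor moves the column index by at most one. From row `0`, column `k` is reached in `k`
factors only by taking the superdiagonal entry every time, and later columns are out of reach. -/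
theorem bidiagonal_pow_zero_apply {m : ℕ} (v : Fin (m + 1) → ℂ) (t : ℂ) (k : ℕ) :
    ∀ j : Fin (m + 1), k ≤ j.val →
      (bidiagonal v t ^ k) 0 j = if j.val = k then t ^ k else 0 := by
  induction k with
  | zero =>
    intro j _
    rw [pow_zero, pow_zero, Matrix.one_apply]
    exact if_congr (by rw [Fin.ext_iff, eq_comm]; rfl) rfl rfl
  | succ k ih =>
    intro j hj
    rw [pow_succ, Matrix.mul_apply,
      Finset.sum_eq_single (⟨j.val - 1, by omega⟩ : Fin (m + 1))]
    · have hne : (⟨j.val - 1, by omega⟩ : Fin (m + 1)) ≠ j := by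
        simp only [ne_eq, Fin.ext_iff]; omega
      have hsucc : j.val - 1 + 1 = j.val := by omega
      rw [ih _ (by simp only; omega), bidiagonal_apply, if_neg hne, if_pos hsucc, zero_add]
      by_cases h : j.val = k + 1
      · rw [if_pos (by simp only; omega), if_pos h, pow_succ]
      · rw [if_neg (by simp only; omega), if_neg h, zero_mul]
    · intro i _ hi
      have hi' : i.val ≠ j.val - 1 := fun h => hi (Fin.ext h)
      rw [bidiagonal_apply, if_neg (by omega : ¬ i.val + 1 = j.val), add_zero]
      by_cases hij : i = j
      · subst hij
        rw [ih _ (by omega), if_neg (by omega), zero_mul]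
      · simp [hij]
    · simp

theorem aeval_bidiagonal_zero_last {m : ℕ} (v : Fin (m + 1) → ℂ) (t : ℂ) (p : ℂ[X])
    (hp : p.degree < (m + 1 : ℕ)) :
    (aeval (bidiagonal v t) p) 0 (Fin.last m) = p.coeff m * t ^ m := by
  have hp' : p.natDegree < m + 1 := by
    rcases eq_or_ne p 0 with rfl | h0
    · simp
    · exact (Polynomial.natDegree_lt_iff_degree_lt h0).2 hp
  rw [Polynomial.aeval_eq_sum_range' hp', Matrix.sum_apply, Finset.sum_eq_single m]
  · rw [Matrix.smul_apply, bidiagonal_pow_zero_apply _ _ _ _ (by simp)]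
    simp
  · intro k hk hkm
    have := Finset.mem_range.1 hk
    rw [Matrix.smul_apply, bidiagonal_pow_zero_apply _ _ _ _ (by simp; omega),
      if_neg (by simp; omega), smul_zero]
  · simp

theorem aeval_conj_diagonal {m : ℕ} (P : (Matrix (Fin m) (Fin m) ℂ)ˣ) (v : Fin m → ℂ)
    (p : ℂ[X]) :
    aeval (P.val * Matrix.diagonal v * P⁻¹.val) p =
      P.val * Matrix.diagonal (fun i => p.eval (v i)) * P⁻¹.val := by
  induction p using Polynomial.induction_on' with
  | add p q hp hq =>
    simp only [map_add, hp, hq, eval_add, ← Matrix.diagonal_add, mul_add, add_mul]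
  | monomial k a =>
    rw [aeval_monomial, Units.conj_pow, Matrix.diagonal_pow, Algebra.algebraMap_eq_smul_one,
      smul_mul_assoc, one_mul]
    have : (Matrix.diagonal fun i => eval (v i) (monomial k a)) =
        a • Matrix.diagonal (v ^ k) := by
      rw [← Matrix.diagonal_smul]
      congr 1
      ext i
      simp
    rw [this, mul_smul_comm, smul_mul_assoc]

end DiagCalc

/-! ### From bounded `f[X]` to convergent Newton interpolation. -/

namespace DiagCalc

open Matrix Polynomial Finset

/-- The extension of `f` by zero to the whole plane. -/
noncomputable def zeroExtend {Ω : Set ℂ} (f : Ω → ℂ) : ℂ → ℂ :=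
  Function.extend Subtype.val f 0

theorem zeroExtend_coe {Ω : Set ℂ} (f : Ω → ℂ) (z : Ω) : zeroExtend f z = f z :=
  Subtype.val_injective.extend_apply f 0 z

/-- The polynomial of degree less than `#s` that agrees with `F` on `s`. -/
noncomputable abbrev interp (s : Finset ℂ) (F : ℂ → ℂ) : ℂ[X] := Lagrange.interpolate s id F

/-- The entry in the corner of `f[X]`, for a bidiagonal `X`, is a multiple of a divided
difference of `f`. -/
theorem norm_coeff_interp_mul_pow_le {Ω : Set ℂ} {f : Ω → ℂ} {l : Ω} {M ε : ℝ} (hε : 0 < ε)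
    (hM : ∀ n : ℕ, 1 ≤ n → ∀ X : D n Ω, ‖X.val - (scalarD n l).val‖ ≤ ε → ‖fop f X‖ ≤ M)
    {s : Finset ℂ} {m : ℕ} (hs : #s = m + 1) (hsΩ : ∀ z ∈ s, z ∈ Ω)
    (hsl : ∀ z ∈ s, ‖z - l‖ ≤ ε / 2) :
    ‖(interp s (zeroExtend f)).coeff m‖ * (ε / 2) ^ m ≤ M := by
  have e := (s.equivFinOfCardEq hs).symm
  set v : Fin (m + 1) → ℂ := fun i => (e i : ℂ) with hv
  have hvinj : Function.Injective v := Subtype.val_injective.comp e.injective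
  have hvs : ∀ i, v i ∈ s := fun i => (e i).2
  -- Half of `ε` is spent on the superdiagonal, the other half on the spread of the nodes around
  -- `l`.
  set t : ℂ := ((ε / 2 : ℝ) : ℂ) with ht
  have hnt : ‖t‖ = ε / 2 := by rw [ht, Complex.norm_real, Real.norm_of_nonneg (by positivity)]
  obtain ⟨P, hP⟩ := exists_eq_conj_diagonal_bidiagonal hvinj t
  let d : Fin (m + 1) → Ω := fun i => ⟨v i, hsΩ _ (hvs i)⟩
  let X : D (m + 1) Ω := ⟨bidiagonal v t, mem_D_iff.2 ⟨P, d, hP⟩⟩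
  have hX : ‖X.val - (scalarD (m + 1) l).val‖ ≤ ε := by
    refine (norm_bidiagonal_sub_le v t l (half_pos hε).le fun i => hsl _ (hvs i)).trans ?_
    rw [hnt, add_halves]
  have hf : fop f X = aeval (bidiagonal v t) (interp s (zeroExtend f)) := by
    rw [fop_eq f X P d hP]
    conv_rhs => rw [hP]
    rw [aeval_conj_diagonal]
    congr 3
    ext i
    rw [← zeroExtend_coe f (d i)]
    exact (Lagrange.eval_interpolate_at_node _ (Set.injOn_id _) (hvs i)).symm
  have hb := (norm_entry_le_l2_opNorm (fop f X) 0 (Fin.last m)).trans (hM _ (by omega) X hX)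
  rwa [hf, aeval_bidiagonal_zero_last _ _ _
    (by rw [← hs]; exact Lagrange.degree_interpolate_lt _ (Set.injOn_id _)),
    norm_mul, norm_pow, hnt] at hb

/-- Newton's form of the interpolating polynomial. -/
theorem interp_insert (F : ℂ → ℂ) {s : Finset ℂ} {z : ℂ} (hz : z ∉ s) :
    interp (insert z s) F =
      interp s F + C ((interp (insert z s) F).coeff #s) * Lagrange.nodal s id := by
  -- Since the nodal polynomial is monic of degree `#s`, subtracting its multiple removes the top
  -- coefficient without changing values on `s`; uniqueness of interpolation concludes.
  rw [← sub_eq_iff_eq_add]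
  refine Lagrange.eq_interpolate_of_eval_eq _ (Set.injOn_id _) ?_ fun a ha => ?_
  · have hdeg : (interp (insert z s) F).degree < (#s + 1 : ℕ) := by
      rw [← Finset.card_insert_of_notMem hz]
      exact Lagrange.degree_interpolate_lt _ (Set.injOn_id _)
    rw [Polynomial.degree_lt_iff_coeff_zero] at hdeg ⊢
    intro k hk
    rw [coeff_sub, coeff_C_mul]
    rcases hk.eq_or_lt with rfl | hk
    · have := (Lagrange.nodal_monic (s := s) (v := (id : ℂ → ℂ))).coeff_natDegree
      rw [Lagrange.natDegree_nodal] at this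
      rw [this, mul_one, sub_self]
    · have hnodal : (Lagrange.nodal s (id : ℂ → ℂ)).coeff k = 0 :=
        Polynomial.coeff_eq_zero_of_natDegree_lt (by rwa [Lagrange.natDegree_nodal])
      rw [hdeg k hk, hnodal, mul_zero, sub_zero]
  · rw [eval_sub, eval_mul, Lagrange.eval_nodal_at_node ha, mul_zero, sub_zero]
    exact Lagrange.eval_interpolate_at_node _ (Set.injOn_id _) (Finset.mem_insert_of_mem ha)

theorem eval_interp_of_mem (F : ℂ → ℂ) {s : Finset ℂ} {z : ℂ} (hz : z ∈ s) :
    (interp s F).eval z = F z :=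
  Lagrange.eval_interpolate_at_node _ (Set.injOn_id _) hz

/-- The increments of the Newton interpolation decay geometrically, near the centre. -/
theorem norm_eval_interp_insert_sub_le {Ω : Set ℂ} {f : Ω → ℂ} {l : Ω} {M ε : ℝ} (hε : 0 < ε)
    (hM : ∀ n : ℕ, 1 ≤ n → ∀ X : D n Ω, ‖X.val - (scalarD n l).val‖ ≤ ε → ‖fop f X‖ ≤ M)
    {s : Finset ℂ} {a : ℂ} (ha : a ∉ s)
    (hs : ∀ w ∈ insert a s, w ∈ Ω ∩ Metric.ball (l : ℂ) (ε / 8))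
    {z : ℂ} (hz : z ∈ Metric.ball (l : ℂ) (ε / 8)) :
    ‖(interp (insert a s) (zeroExtend f)).eval z - (interp s (zeroExtend f)).eval z‖
      ≤ M * (1 / 2) ^ #s := by
  have hc := norm_coeff_interp_mul_pow_le hε hM (Finset.card_insert_of_notMem ha)
    (fun w hw => (hs w hw).1) fun w hw => by
      have := (hs w hw).2
      rw [mem_ball_iff_norm] at this
      linarith
  -- Two points of the ball are less than `2 * (ε / 8)` apart, half of the `ε / 2` in the
  -- coefficient bound; hence the ratio `1 / 2`.
  have hprod : ‖(Lagrange.nodal s id).eval z‖ ≤ (ε / 4) ^ #s := by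
    rw [Lagrange.eval_nodal, norm_prod]
    refine (Finset.prod_le_prod (fun _ _ => norm_nonneg _) fun w hw => ?_).trans_eq
      (Finset.prod_const (ε / 4))
    have h1 := (hs w (Finset.mem_insert_of_mem hw)).2
    rw [Metric.mem_ball] at h1 hz
    rw [id, ← dist_eq_norm]
    have := dist_triangle_right z w l
    linarith
  have hsub : (interp (insert a s) (zeroExtend f)).eval z - (interp s (zeroExtend f)).eval z =
      (interp (insert a s) (zeroExtend f)).coeff #s * (Lagrange.nodal s id).eval z := by
    have := congrArg (Polynomial.eval z) (interp_insert (zeroExtend f) ha)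
    rw [eval_add, eval_mul, eval_C] at this
    rw [this, add_sub_cancel_left]
  rw [hsub, norm_mul]
  calc _ ≤ ‖(interp (insert a s) (zeroExtend f)).coeff #s‖ * (ε / 4) ^ #s := by gcongr
    _ = ‖(interp (insert a s) (zeroExtend f)).coeff #s‖ * (ε / 2) ^ #s * (1 / 2) ^ #s := by
      rw [mul_assoc, ← mul_pow]; ring_nf
    _ ≤ _ := by gcongr

open Filter Topology in
theorem exists_holomorphic_near_accPt {Ω : Set ℂ} {f : Ω → ℂ} {l : Ω} {M ε : ℝ} (hε : 0 < ε)
    (hM : ∀ n : ℕ, 1 ≤ n → ∀ X : D n Ω, ‖X.val - (scalarD n l).val‖ ≤ ε → ‖fop f X‖ ≤ M)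
    (hacc : AccPt (l : ℂ) (𝓟 Ω)) :
    ∃ g : ℂ → ℂ, DifferentiableOn ℂ g (Metric.ball (l : ℂ) (ε / 8)) ∧
      ∀ z : Ω, (z : ℂ) ∈ Metric.ball (l : ℂ) (ε / 8) → g z = f z := by
  have hinf : (Ω ∩ Metric.ball (l : ℂ) (ε / 8)).Infinite := by
    intro hfin
    have hB : Metric.ball (l : ℂ) (ε / 8) ∈ 𝓝 (l : ℂ) := Metric.ball_mem_nhds _ (by positivity)
    have h1 := accPt_iff_frequently_nhdsNE.1 hacc
    have h2 : (Ω ∩ Metric.ball (l : ℂ) (ε / 8))ᶜ ∈ 𝓝[≠] (l : ℂ) := by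
      have h3 : ((Ω ∩ Metric.ball (l : ℂ) (ε / 8)) \ {(l : ℂ)})ᶜ ∈ 𝓝 (l : ℂ) :=
        (hfin.subset Set.sdiff_subset).isClosed.isOpen_compl.mem_nhds (by simp)
      filter_upwards [nhdsWithin_le_nhds h3, self_mem_nhdsWithin] with z hz hzl hz'
      exact hz ⟨hz', hzl⟩
    obtain ⟨z, hzΩ, hz, hzB⟩ := (h1.and_eventually
      (Filter.Eventually.and h2 (nhdsWithin_le_nhds hB))).exists
    exact hz ⟨hzΩ, hzB⟩
  let a : ℕ → ℂ := fun n => (hinf.natEmbedding _ n).1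
  have ha : Function.Injective a :=
    Subtype.val_injective.comp (hinf.natEmbedding _).injective
  have haB : ∀ n, a n ∈ Ω ∩ Metric.ball (l : ℂ) (ε / 8) := fun n => (hinf.natEmbedding _ n).2
  let s : ℕ → Finset ℂ := fun n => (Finset.range n).image a
  have hcard : ∀ n, #(s n) = n := fun n => by
    rw [Finset.card_image_of_injective _ ha, Finset.card_range]
  have hsucc : ∀ n, s (n + 1) = insert (a n) (s n) := fun n => by
    simp only [s]
    rw [Finset.range_add_one, Finset.image_insert]
  have hsB : ∀ n, ∀ w ∈ s n, w ∈ Ω ∩ Metric.ball (l : ℂ) (ε / 8) := fun n w hw => by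
    obtain ⟨k, _, rfl⟩ := Finset.mem_image.1 hw
    exact haB k
  have hnot : ∀ n, a n ∉ s n := fun n h => by
    obtain ⟨k, hk, hkn⟩ := Finset.mem_image.1 h
    exact (Finset.mem_range.1 hk).ne (ha hkn)
  set F := zeroExtend f with hF
  let p : ℕ → ℂ[X] := fun n => interp (s n) F
  have hincr : ∀ n, ∀ z ∈ Metric.ball (l : ℂ) (ε / 8),
      ‖(p (n + 1)).eval z - (p n).eval z‖ ≤ M * (1 / 2) ^ n := fun n z hz => by
    have := norm_eval_interp_insert_sub_le hε hM (hnot n)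
      (by rw [← hsucc]; exact hsB (n + 1)) hz
    rwa [hcard, ← hsucc] at this
  have hsum : Summable fun n : ℕ => M * (1 / 2 : ℝ) ^ n := summable_geometric_two.mul_left M
  refine ⟨fun z => ∑' n, ((p (n + 1)).eval z - (p n).eval z),
    Complex.differentiableOn_tsum_of_summable_norm hsum
      (fun n => ((p (n + 1)).differentiable.sub (p n).differentiable).differentiableOn)
      Metric.isOpen_ball hincr, fun z hz => ?_⟩
  have h1 := (Summable.of_norm_bounded hsum (fun n => hincr n z hz)).hasSum.tendsto_sum_nat
  have hp0 : p 0 = 0 := by simp [p, s]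
  simp only [Finset.sum_range_sub (fun n => (p n).eval (z : ℂ)), hp0, eval_zero, sub_zero] at h1
  refine tendsto_nhds_unique h1 ?_
  rw [tendsto_iff_norm_sub_tendsto_zero]
  -- The interpolation error at `z` is the increment obtained by adding `z` itself as the next node,
  -- so it has the same geometric bound.
  refine squeeze_zero (fun _ => norm_nonneg _) (fun n => ?_) hsum.tendsto_atTop_zero
  rw [norm_sub_rev, ← zeroExtend_coe f z]
  by_cases hzs : (z : ℂ) ∈ s n
  · rw [eval_interp_of_mem F hzs, sub_self, norm_zero]
    exact (norm_nonneg _).trans (hincr n z hz)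
  · have := norm_eval_interp_insert_sub_le hε hM hzs
      (fun w hw => by
        rcases Finset.mem_insert.1 hw with rfl | hw
        · exact ⟨z.2, hz⟩
        · exact hsB n w hw) hz
    rwa [hcard, eval_interp_of_mem _ (Finset.mem_insert_self _ _)] at this

end DiagCalc

/-! ### Gluing local extensions. -/

namespace DiagCalc

open Filter Topology Metric

/-- This is the identity theorem: an intersection of two balls is convex, hence connected. -/
theorem eqOn_inter_of_eqOn_accPt {Ω : Set ℂ} {c₁ c₂ : ℂ} {r₁ r₂ : ℝ} {g₁ g₂ : ℂ → ℂ}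
    (h₁ : DifferentiableOn ℂ g₁ (ball c₁ r₁)) (h₂ : DifferentiableOn ℂ g₂ (ball c₂ r₂))
    (h : ∀ z ∈ Ω, z ∈ ball c₁ r₁ → z ∈ ball c₂ r₂ → g₁ z = g₂ z)
    {w : ℂ} (hw : AccPt w (𝓟 Ω)) (hw₁ : w ∈ ball c₁ r₁) (hw₂ : w ∈ ball c₂ r₂) :
    Set.EqOn g₁ g₂ (ball c₁ r₁ ∩ ball c₂ r₂) := by
  have ho : IsOpen (ball c₁ r₁ ∩ ball c₂ r₂) := isOpen_ball.inter isOpen_ball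
  refine AnalyticOnNhd.eqOn_of_preconnected_of_frequently_eq
    ((h₁.mono Set.inter_subset_left).analyticOnNhd ho)
    ((h₂.mono Set.inter_subset_right).analyticOnNhd ho)
    ((convex_ball c₁ r₁).inter (convex_ball c₂ r₂)).isPreconnected ⟨hw₁, hw₂⟩ ?_
  refine ((accPt_iff_frequently_nhdsNE.1 hw).and_eventually
    (nhdsWithin_le_nhds (ho.mem_nhds ⟨hw₁, hw₂⟩))).mono ?_
  rintro z ⟨hz, hz₁, hz₂⟩
  exact h z hz hz₁ hz₂

/-- Holomorphic extensions near the accumulation points of `Ω` that belong to `Ω` can be glued. -/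
theorem exists_holomorphic_near_accPts {Ω : Set ℂ} {F : ℂ → ℂ}
    (hloc : ∀ l ∈ Ω, AccPt l (𝓟 Ω) → ∃ r > 0, ∃ g : ℂ → ℂ, DifferentiableOn ℂ g (ball l r) ∧
      ∀ z ∈ Ω, z ∈ ball l r → g z = F z) :
    ∃ U : Set ℂ, IsOpen U ∧ (∀ l ∈ Ω, AccPt l (𝓟 Ω) → l ∈ U) ∧
      ∃ g : ℂ → ℂ, DifferentiableOn ℂ g U ∧ ∀ z ∈ Ω, z ∈ U → g z = F z := by
  classical
  let A : Set ℂ := {l | l ∈ Ω ∧ AccPt l (𝓟 Ω)}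
  choose! r hr G hG hGF using fun (l : ℂ) (hl : l ∈ A) => hloc l hl.1 hl.2
  have hsub : ∀ l ∈ A, ∀ z, z ∈ ball l (r l / 3) → z ∈ ball l (r l) := fun l hl z hz =>
    ball_subset_ball (by linarith [hr l hl]) hz
  have key : ∀ l ∈ A, ∀ m ∈ A, r m ≤ r l → ∀ z, z ∈ ball l (r l / 3) → z ∈ ball m (r m / 3) →
      G l z = G m z := by
    intro l hl m hm hml z hzl hzm
    -- With radii cut to a third, the centre `m` of the smaller ball lies in the full ball around
    -- `l`, so it serves as the common accumulation point.
    refine eqOn_inter_of_eqOn_accPt (hG l hl) (hG m hm)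
      (fun w hw h1 h2 => (hGF l hl w hw h1).trans (hGF m hm w hw h2).symm) hm.2 ?_
      (mem_ball_self (hr m hm)) ⟨hsub l hl z hzl, hsub m hm z hzm⟩
    rw [mem_ball] at *
    have := dist_triangle_left m l z
    linarith [hr l hl]
  have key' : ∀ l ∈ A, ∀ m ∈ A, ∀ z, z ∈ ball l (r l / 3) → z ∈ ball m (r m / 3) →
      G l z = G m z := fun l hl m hm z hzl hzm =>
    (le_total (r m) (r l)).elim (fun h => key l hl m hm h z hzl hzm)
      fun h => (key m hm l hl h z hzm hzl).symm
  let g : ℂ → ℂ := fun z =>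
    if h : ∃ l ∈ A, z ∈ ball l (r l / 3) then G h.choose z else 0
  have hg : ∀ l ∈ A, ∀ z, z ∈ ball l (r l / 3) → g z = G l z := by
    intro l hl z hz
    have h : ∃ l ∈ A, z ∈ ball l (r l / 3) := ⟨l, hl, hz⟩
    simp only [g, dif_pos h]
    exact key' _ h.choose_spec.1 l hl z h.choose_spec.2 hz
  refine ⟨⋃ l ∈ A, ball l (r l / 3), isOpen_biUnion fun _ _ => isOpen_ball,
    fun l hl hacc => Set.mem_biUnion (show l ∈ A from ⟨hl, hacc⟩)
      (mem_ball_self (by linarith [hr l ⟨hl, hacc⟩])), g, ?_, ?_⟩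
  · intro z hz
    obtain ⟨l, hl, hzl⟩ := Set.mem_iUnion₂.1 hz
    have hd := ((hG l hl).mono (ball_subset_ball (by linarith [hr l hl]))).differentiableAt
      (isOpen_ball.mem_nhds hzl)
    refine (hd.congr_of_eventuallyEq ?_).differentiableWithinAt
    filter_upwards [isOpen_ball.mem_nhds hzl] with w hw using hg l hl w hw
  · intro z hzΩ hz
    obtain ⟨l, hl, hzl⟩ := Set.mem_iUnion₂.1 hz
    rw [hg l hl z hzl, hGF l hl z hzΩ (hsub l hl z hzl)]

/-- Any function on a set of isolated points of `Ω` extends to a locally constant function. -/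
theorem exists_holomorphic_near_isolated {Ω I : Set ℂ} (hI : I ⊆ Ω)
    (hacc : ∀ l ∈ I, ¬ AccPt l (𝓟 Ω)) (F : ℂ → ℂ) :
    ∃ U : Set ℂ, IsOpen U ∧ I ⊆ U ∧ U ∩ Ω ⊆ I ∧
      ∃ g : ℂ → ℂ, DifferentiableOn ℂ g U ∧ ∀ z ∈ I, g z = F z := by
  classical
  have hex : ∀ l ∈ I, ∃ r > 0, ∀ z ∈ Ω, z ∈ ball l r → z = l := by
    intro l hl
    have h := hacc l hl
    rw [accPt_iff_nhds] at h
    push Not at h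
    obtain ⟨u, hu, h⟩ := h
    obtain ⟨r, hr, hru⟩ := Metric.mem_nhds_iff.1 hu
    exact ⟨r, hr, fun z hz hzr => h z ⟨hru hzr, hz⟩⟩
  choose! r hr hrΩ using hex
  have huniq : ∀ l ∈ I, ∀ m ∈ I, r m ≤ r l → ∀ z, z ∈ ball l (r l / 2) → z ∈ ball m (r m / 2) →
      m = l := by
    intro l hl m hm hml z hzl hzm
    refine hrΩ l hl m (hI hm) ?_
    rw [mem_ball] at *
    have := dist_triangle_left m l z
    linarith
  have huniq' : ∀ l ∈ I, ∀ m ∈ I, ∀ z, z ∈ ball l (r l / 2) → z ∈ ball m (r m / 2) → m = l :=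
    fun l hl m hm z hzl hzm => (le_total (r m) (r l)).elim
      (fun h => huniq l hl m hm h z hzl hzm) fun h => (huniq m hm l hl h z hzm hzl).symm
  let g : ℂ → ℂ := fun z =>
    if h : ∃ l ∈ I, z ∈ ball l (r l / 2) then F h.choose else 0
  have hg : ∀ l ∈ I, ∀ z, z ∈ ball l (r l / 2) → g z = F l := by
    intro l hl z hz
    have h : ∃ l ∈ I, z ∈ ball l (r l / 2) := ⟨l, hl, hz⟩
    simp only [g, dif_pos h]
    rw [huniq' l hl _ h.choose_spec.1 z hz h.choose_spec.2]
  have hself : ∀ l ∈ I, l ∈ ball l (r l / 2) := fun l hl =>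
    mem_ball_self (by linarith [hr l hl])
  refine ⟨⋃ l ∈ I, ball l (r l / 2), isOpen_biUnion fun _ _ => isOpen_ball,
    fun l hl => Set.mem_biUnion hl (hself l hl), ?_, g, ?_, fun z hz => hg z hz z (hself z hz)⟩
  · rintro z ⟨hz, hzΩ⟩
    obtain ⟨l, hl, hzl⟩ := Set.mem_iUnion₂.1 hz
    rwa [hrΩ l hl z hzΩ (ball_subset_ball (by linarith [hr l hl]) hzl)]
  · intro z hz
    obtain ⟨l, hl, hzl⟩ := Set.mem_iUnion₂.1 hz
    refine ((differentiableAt_const (F l)).congr_of_eventuallyEq ?_).differentiableWithinAt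
    filter_upwards [isOpen_ball.mem_nhds hzl] with w hw using hg l hl w hw

/-- A function on `Ω` that extends holomorphically near every accumulation point of `Ω` in `Ω`
extends holomorphically to a neighbourhood of `Ω`. -/
theorem exists_holomorphic_extension {Ω : Set ℂ} {F : ℂ → ℂ}
    (hloc : ∀ l ∈ Ω, AccPt l (𝓟 Ω) → ∃ r > 0, ∃ g : ℂ → ℂ, DifferentiableOn ℂ g (ball l r) ∧
      ∀ z ∈ Ω, z ∈ ball l r → g z = F z) :
    ∃ U : Set ℂ, IsOpen U ∧ Ω ⊆ U ∧
      ∃ g : ℂ → ℂ, DifferentiableOn ℂ g U ∧ ∀ z ∈ Ω, g z = F z := by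
  classical
  obtain ⟨U₁, ho₁, hacc₁, g₁, hd₁, hg₁⟩ := exists_holomorphic_near_accPts hloc
  obtain ⟨U₂, ho₂, hI₂, hU₂, g₂, hd₂, hg₂⟩ := exists_holomorphic_near_isolated
    (I := Ω \ U₁) Set.sdiff_subset (fun l hl h => hl.2 (hacc₁ l hl.1 h)) F
  -- `g₁` and `g₂` may disagree on `U₁ ∩ U₂`. The two pieces of `Ω` are separated, neither meeting
  -- the closure of the other, so complete normality provides disjoint open neighbourhoods on which
  -- to use them.
  have hc₁ : Disjoint (closure (Ω ∩ U₁)) (Ω \ U₁) := by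
    refine Disjoint.mono_right hI₂ (Disjoint.closure_left ?_ ho₂)
    exact Set.disjoint_left.2 fun z hz hz₂ => (hU₂ ⟨hz₂, hz.1⟩).2 hz.2
  have hc₂ : Disjoint (Ω ∩ U₁) (closure (Ω \ U₁)) := by
    refine Disjoint.mono_left Set.inter_subset_right ?_
    exact Disjoint.closure_right Set.disjoint_sdiff_right ho₁
  obtain ⟨V₁, V₂, hV₁, hV₂, hΩ₁, hΩ₂, hV⟩ :=
    separatedNhds_iff_disjoint.2 (CompletelyNormalSpace.completely_normal hc₁ hc₂)
  have hdisj : ∀ z, z ∈ V₁ → z ∉ V₂ := fun z h1 h2 => Set.disjoint_left.1 hV h1 h2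
  refine ⟨(V₁ ∩ U₁) ∪ (V₂ ∩ U₂), (hV₁.inter ho₁).union (hV₂.inter ho₂), ?_,
    fun z => if z ∈ V₁ then g₁ z else g₂ z, ?_, ?_⟩
  · intro z hz
    by_cases h : z ∈ U₁
    · exact Or.inl ⟨hΩ₁ ⟨hz, h⟩, h⟩
    · exact Or.inr ⟨hΩ₂ ⟨hz, h⟩, hI₂ ⟨hz, h⟩⟩
  · rintro z (⟨h1, h2⟩ | ⟨h1, h2⟩)
    · refine ((hd₁.differentiableAt (ho₁.mem_nhds h2)).congr_of_eventuallyEq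
        ?_).differentiableWithinAt
      filter_upwards [hV₁.mem_nhds h1] with w hw using if_pos hw
    · refine ((hd₂.differentiableAt (ho₂.mem_nhds h2)).congr_of_eventuallyEq
        ?_).differentiableWithinAt
      filter_upwards [hV₂.mem_nhds h1] with w hw using if_neg fun h => hdisj w h hw
  · intro z hz
    simp only
    by_cases h : z ∈ U₁
    · rw [if_pos (hΩ₁ ⟨hz, h⟩), hg₁ z hz h]
    · rw [if_neg fun h' => hdisj z h' (hΩ₂ ⟨hz, h⟩), hg₂ z ⟨hz, h⟩]

end DiagCalc

/-! ### Power series of matrices and continuity of the calculus. -/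

namespace DiagCalc

open Filter Topology

theorem norm_sub_le_of_eq_conj_diagonal {n : ℕ} (P : (Matrix (Fin n) (Fin n) ℂ)ˣ) (d : Fin n → ℂ)
    (l : ℂ) (i : Fin n) :
    ‖d i - l‖ ≤ ‖P.val * Matrix.diagonal d * P⁻¹.val - l • (1 : Matrix (Fin n) (Fin n) ℂ)‖ := by
  have : Nonempty (Fin n) := ⟨i⟩
  refine spectrum.norm_le_norm_of_mem (𝕜 := ℂ) ?_
  have h : d i ∈ spectrum ℂ (P.val * Matrix.diagonal d * P⁻¹.val) := by
    rw [spectrum.units_conjugate, spectrum_diagonal]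
    exact ⟨i, rfl⟩
  rw [← Algebra.algebraMap_eq_smul_one, ← spectrum.sub_singleton_eq]
  exact Set.sub_mem_sub h rfl

/-- Conjugation by `P` is continuous and linear, so convergence at each eigenvalue suffices, without
any control of `P`. -/
theorem hasSum_conj_diagonal {n : ℕ} (P : (Matrix (Fin n) (Fin n) ℂ)ˣ) {d : Fin n → ℂ}
    {l : ℂ} {g : ℂ → ℂ} {c : ℕ → ℂ}
    (h : ∀ i, HasSum (fun k => (d i - l) ^ k * c k) (g (d i))) :
    HasSum (fun k => c k •
        (P.val * Matrix.diagonal d * P⁻¹.val - l • (1 : Matrix (Fin n) (Fin n) ℂ)) ^ k)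
      (P.val * Matrix.diagonal (fun i => g (d i)) * P⁻¹.val) := by
  have h1 : HasSum (fun k i => (d i - l) ^ k * c k) (fun i => g (d i)) := Pi.hasSum.2 h
  have h2 := (h1.matrix_diagonal.mul_left P.val).mul_right P⁻¹.val
  convert! h2 using 2 with k
  have h3 : P.val * Matrix.diagonal d * P⁻¹.val - l • (1 : Matrix (Fin n) (Fin n) ℂ) =
      P.val * Matrix.diagonal (fun i => d i - l) * P⁻¹.val := by
    rw [← Matrix.diagonal_sub, mul_sub, sub_mul, ← Matrix.smul_one_eq_diagonal, mul_smul_comm,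
      mul_one, smul_mul_assoc, Units.mul_inv]
  have h4 : (Matrix.diagonal fun i => (d i - l) ^ k * c k) =
      c k • Matrix.diagonal ((fun i => d i - l) ^ k) := by
    rw [← Matrix.diagonal_smul]
    congr 1
    ext i
    simp [mul_comm]
  rw [h3, h4, Units.conj_pow, Matrix.diagonal_pow, mul_smul_comm, smul_mul_assoc]

theorem exists_forall_norm_fop_sub_le {Ω : Set ℂ} {f : Ω → ℂ} {l : Ω} {g : ℂ → ℂ}
    (hg : AnalyticAt ℂ g l) (hgf : ∀ z : Ω, g z = f z) {ε : ℝ} (hε : 0 < ε) :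
    ∃ δ : ℝ, 0 < δ ∧ ∀ n : ℕ, ∀ X : D n Ω, ‖X.val - (scalarD n l).val‖ ≤ δ →
      ‖fop f X - fop f (scalarD n l)‖ ≤ ε := by
  obtain ⟨p, hp⟩ := hg
  obtain ⟨C, r, hC, hr, hb⟩ := p.le_mul_pow_of_radius_pos hp.radius_pos
  obtain ⟨ρ, hρ, hball⟩ := Metric.eventually_nhds_iff.1 (hasFPowerSeriesAt_iff'.1 hp)
  -- The first bound keeps the eigenvalues where the series represents `g`, the second makes the
  -- ratio `r * ‖Y‖` at most `1 / 2`, and the third makes the resulting geometric sum at most `ε`.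
  refine ⟨min (ρ / 2) (min (1 / (2 * r)) (ε / (2 * C * r))), by positivity, fun n X hX => ?_⟩
  obtain ⟨P, d, hPd⟩ := mem_D_iff.1 X.2
  set Y := X.val - (scalarD n l).val with hY
  have hY1 : ‖Y‖ ≤ ρ / 2 := hX.trans (min_le_left _ _)
  have hY2 : ‖Y‖ ≤ 1 / (2 * r) := hX.trans ((min_le_right _ _).trans (min_le_left _ _))
  have hY3 : ‖Y‖ ≤ ε / (2 * C * r) := hX.trans ((min_le_right _ _).trans (min_le_right _ _))
  have hYeq : Y = P.val * Matrix.diagonal (fun i => (d i : ℂ)) * P⁻¹.val -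
      (l : ℂ) • (1 : Matrix (Fin n) (Fin n) ℂ) := by rw [hY, hPd]; rfl
  have hd : ∀ i, ‖(d i : ℂ) - l‖ ≤ ‖Y‖ := fun i => by
    rw [hYeq]; exact norm_sub_le_of_eq_conj_diagonal P (fun i => (d i : ℂ)) l i
  have hs := hasSum_conj_diagonal P (d := fun i => (d i : ℂ)) (l := l) (g := g) (c := p.coeff)
    fun i => hball (by rw [dist_eq_norm]; linarith [hd i])
  rw [← hYeq] at hs
  simp only [hgf] at hs
  rw [← fop_eq f X P d hPd] at hs
  have hl : fop f (scalarD n l) = p.coeff 0 • Y ^ 0 := by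
    have h0 : p.coeff 0 = f l := by
      rw [← hgf l, FormalMultilinearSeries.coeff, hp.coeff_zero]
    rw [fop_eq f (scalarD n l) 1 (fun _ => l) (by simp [scalarD, Matrix.smul_one_eq_diagonal]),
      h0]
    simp [Matrix.smul_one_eq_diagonal]
  rw [hl]
  -- The constant term is `f[λI]`, so the difference to be estimated is the tail from exponent `1`.
  have hs' := (hasSum_nat_add_iff' 1).2 hs
  rw [Finset.sum_range_one] at hs'
  have hrY : r * ‖Y‖ ≤ 1 / 2 := by
    calc r * ‖Y‖ ≤ r * (1 / (2 * r)) := by gcongr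
      _ = 1 / 2 := by field_simp
  have hgeo : HasSum (fun k : ℕ => C * (r * ‖Y‖) * (1 / 2 : ℝ) ^ k) (C * (r * ‖Y‖) * 2) :=
    hasSum_geometric_two.mul_left _
  have hbound : ∀ k : ℕ, ‖p.coeff (k + 1) • Y ^ (k + 1)‖ ≤ C * (r * ‖Y‖) * (1 / 2 : ℝ) ^ k := by
    intro k
    rw [norm_smul, ← FormalMultilinearSeries.norm_apply_eq_norm_coef]
    calc ‖p (k + 1)‖ * ‖Y ^ (k + 1)‖ ≤ (C * r ^ (k + 1)) * ‖Y‖ ^ (k + 1) := by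
          gcongr
          · exact hb _
          · exact norm_pow_le' _ k.succ_pos
      _ = C * (r * ‖Y‖) * (r * ‖Y‖) ^ k := by ring
      _ ≤ _ := by gcongr
  have hle := hs'.norm_le_of_bounded hgeo hbound
  refine hle.trans ?_
  calc C * (r * ‖Y‖) * 2 = 2 * C * r * ‖Y‖ := by ring
    _ ≤ 2 * C * r * (ε / (2 * C * r)) := by gcongr
    _ = ε := by field_simp

theorem norm_fop_scalarD_le {Ω : Set ℂ} (f : Ω → ℂ) (n : ℕ) (l : Ω) :
    ‖fop f (scalarD n l)‖ ≤ ‖f l‖ := by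
  rw [fop_eq f (scalarD n l) 1 (fun _ => l) (by simp [scalarD, Matrix.smul_one_eq_diagonal])]
  simp only [Units.val_one, inv_one, one_mul, mul_one, Matrix.l2_opNorm_diagonal]
  exact (pi_norm_le_iff_of_nonneg (norm_nonneg _)).2 fun _ => le_rfl

end DiagCalc

theorem theorem1p2 (Ω : Set ℂ) (f : Ω → ℂ) :
    List.TFAE [
      ∀ l : Ω, ∃ M : ℝ, 0 < M ∧ ∃ ε : ℝ, 0 < ε ∧ ∀ n : ℕ, 1 ≤ n → ∀ X : DiagCalc.D n Ω,
        ‖X.val - (DiagCalc.scalarD n l).val‖ ≤ ε → ‖DiagCalc.fop f X‖ ≤ M,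
      ∀ l : Ω, ∀ ε : ℝ, 0 < ε → ∃ δ : ℝ, 0 < δ ∧ ∀ n : ℕ, 1 ≤ n → ∀ X : DiagCalc.D n Ω,
        ‖X.val - (DiagCalc.scalarD n l).val‖ ≤ δ →
          ‖DiagCalc.fop f X - DiagCalc.fop f (DiagCalc.scalarD n l)‖ ≤ ε,
      ∃ U : Set ℂ, IsOpen U ∧ Ω ⊆ U ∧ ∃ g : ℂ → ℂ, DifferentiableOn ℂ g U ∧
        ∀ z : Ω, g z = f z] := by
  tfae_have 1 → 3 := by
    intro h
    obtain ⟨U, hU, hΩ, g, hg, hgf⟩ := DiagCalc.exists_holomorphic_extension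
      (Ω := Ω) (F := DiagCalc.zeroExtend f) fun l hl hacc => by
        obtain ⟨M, -, ε, hε, hM⟩ := h ⟨l, hl⟩
        obtain ⟨g, hg, hgf⟩ := DiagCalc.exists_holomorphic_near_accPt hε hM hacc
        exact ⟨ε / 8, by positivity, g, hg, fun z hz hzb =>
          (hgf ⟨z, hz⟩ hzb).trans (DiagCalc.zeroExtend_coe f ⟨z, hz⟩).symm⟩
    exact ⟨U, hU, hΩ, g, hg, fun z => (hgf z z.2).trans (DiagCalc.zeroExtend_coe f z)⟩
  tfae_have 3 → 2 := by
    rintro ⟨U, hU, hΩ, g, hg, hgf⟩ l ε hε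
    obtain ⟨δ, hδ, h⟩ := DiagCalc.exists_forall_norm_fop_sub_le
      (hg.analyticAt (hU.mem_nhds (hΩ l.2))) hgf hε
    exact ⟨δ, hδ, fun n _ => h n⟩
  tfae_have 2 → 1 := by
    intro h l
    obtain ⟨δ, hδ, h⟩ := h l 1 one_pos
    refine ⟨1 + ‖f l‖, by positivity, δ, hδ, fun n hn X hX => ?_⟩
    have h1 := norm_le_norm_sub_add (DiagCalc.fop f X) (DiagCalc.fop f (DiagCalc.scalarD n l))
    exact h1.trans (add_le_add (h n hn X hX) (DiagCalc.norm_fop_scalarD_le f n l))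
  tfae_finish
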